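/- Let $B=\{(u,v)\in\mathbb R^2: u^2+v^2<1\}$, write $w=u+iv$, $u^1=u$, $u^2=v$. Let $X\in C^{k,\alpha}(\overline B,\mathbb R^4)$, with an integer $k\ge 3$ and $\alpha\in(0,1)$, be an immersion ($X_u,X_v$ linearly independent on $\overline B$) with first fundamental form $g_{ij}=X_{u^i}\cdot X_{u^j}$ and area element $W=\sqrt{g_{11}g_{22}-g_{12}^2}$, and let $X$ be conformally parametrized, i.e. $g_{11}=g_{22}=W$ and $g_{12}=0$ on $\overline B$. A normal frame of $X$ is a pair $N=(N_1,N_2)$ of maps in $C^{k-1,\alpha}(\overline B,\mathbb R^4)$ which at each $w\in\overline B$ form an orthonormal basis of the normal space $\{Z: Z\cdot X_u=Z\cdot X_v=0\}$ with $\det(X_u,X_v,N_1,N_2)>0$. Its torsion coefficients are $T_{\sigma,i}^{\vartheta}=N_{\sigma,u^i}\cdot N_\vartheta$, its total torsion is $$\mathcal T(N)=\sum_{i,j=1}^2\sum_{\sigma,\vartheta=1}^2\iint_B g^{ij}\,T_{\sigma,i}^\vartheta T_{\sigma,j}^\vartheta\,W\,du\,dv,$$ and the normal curvature $S_N$ is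 given by $S_NW=S_{1,12}^2$, where $$S_{\sigma,ij}^{\omega}=\partial_{u^j}T_{\sigma,i}^{\omega}-\partial_{u^i}T_{\sigma,j}^{\omega}+\sum_{\vartheta=1}^2\big(T_{\sigma,i}^\vartheta T_{\vartheta,j}^\omega-T_{\sigma,j}^\vartheta T_{\vartheta,i}^\omega\big).$$ $N$ is called a normal Coulomb frame if it is critical for the total torsion with respect to rotations of the frame, i.e. if for every $\varphi\in C^\infty(\overline B,\mathbb R)$ $$\frac{d}{d\varepsilon}\Big|_{\varepsilon=0}\mathcal T\big(\cos(\varepsilon\varphi)N_1+\sin(\varepsilon\varphi)N_2,\,-\sin(\varepsilon\varphi)N_1+\cos(\varepsilon\varphi)N_2\big)=0.$$ Theorem. For every $p\in(2,+\infty]$ there is a constant $c(p)>0$, depending only on $p$, such that for every conformally parametrized immersion $X\colon\overline B\to\mathbb R^4$ as above and every normal Coulomb frame $N=(N_1,N_2)$ of $X$, the function $S_NW$ belongs to $L^p(B)$ and the complex-valued torsion $\Psi:=T_{1,1}^2-i\,T_{1,2}^2$ satisfies $$|\Psi(w)|\le c(p)\,\|S_NW\|_{L^p(B)}\qquad\text{for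 all } w\in B.$$ -/

import Mathlib

open Set MeasureTheory Metric
open scoped ENNReal NNReal ContDiff

namespace CoulombFrame

noncomputable section

/-- The ambient Euclidean space `ℝ⁴`. -/
abbrev E4 : Type := EuclideanSpace ℝ (Fin 4)

/-- The open unit disc `B`; the parameter plane `ℝ²` is identified with `ℂ` by `w = u + i v`. -/
def disc : Set ℂ := ball 0 1

/-- The closed unit disc. -/
def cdisc : Set ℂ := closedBall 0 1

/-- The coordinate directions: index `0` is the direction of `u¹ = u`, index `1` that of
`u² = v`. -/
def dir : Fin 2 → ℂ := ![1, Complex.I]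

/-- The partial derivative with respect to `uⁱ` of a function on the closed disc
(one-sided where necessary at boundary points). -/
def pd {F : Type*} [NormedAddCommGroup F] [NormedSpace ℝ F]
    (f : ℂ → F) (i : Fin 2) (w : ℂ) : F :=
  fderivWithin ℝ f cdisc w (dir i)

/-- The Hölder class `C^{k,α}` on the closed disc: all derivatives up to order `k` exist and are
continuous up to the boundary, and the `k`-th one is Hölder continuous with exponent `α`. -/
def IsHolderSmooth {F : Type*} [NormedAddCommGroup F] [NormedSpace ℝ F]
    (k : ℕ) (α : ℝ≥0) (f : ℂ → F) : Prop :=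
  ContDiffOn ℝ k f cdisc ∧ ∃ C : ℝ≥0, HolderOnWith C α (iteratedFDerivWithin ℝ k f cdisc) cdisc

/-- `X` is an immersion of the closed disc into `ℝ⁴` of class `C^{k,α}`. -/
structure IsImmersion (k : ℕ) (α : ℝ≥0) (X : ℂ → E4) : Prop where
  smooth : IsHolderSmooth k α X
  linearIndependent : ∀ w ∈ cdisc, LinearIndependent ℝ (fun i => pd X i w)

/-- The first fundamental form `g_{ij} = X_{uⁱ} · X_{uʲ}`. -/
def metric (X : ℂ → E4) (w : ℂ) : Matrix (Fin 2) (Fin 2) ℝ :=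
  Matrix.of fun i j => inner ℝ (pd X i w) (pd X j w)

/-- The area element `W = √(g₁₁ g₂₂ - g₁₂²)`. -/
def area (X : ℂ → E4) (w : ℂ) : ℝ := √(metric X w).det

/-- `X` is conformally parametrized: `g₁₁ = W = g₂₂` and `g₁₂ = 0` on the closed disc. -/
def IsConformal (X : ℂ → E4) : Prop :=
  ∀ w ∈ cdisc, metric X w 0 0 = area X w ∧ metric X w 1 1 = area X w ∧ metric X w 0 1 = 0

/-- The normal space of `X` at `w`: all vectors orthogonal to `X_u(w)` and `X_v(w)`. -/
def normalSpace (X : ℂ → E4) (w : ℂ) : Submodule ℝ E4 :=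
  (Submodule.span ℝ (Set.range fun i => pd X i w))ᗮ

/-- `N = (N₁, N₂)` (indices `0` and `1`) is a normal frame of the immersion `X` of class
`C^{k,α}`: of class `C^{k-1,α}`, orthonormal, spanning the normal space and positively oriented. -/
structure IsNormalFrame (k : ℕ) (α : ℝ≥0) (X : ℂ → E4) (N : Fin 2 → ℂ → E4) : Prop where
  smooth : ∀ σ, IsHolderSmooth (k - 1) α (N σ)
  orthonormal : ∀ w ∈ cdisc, Orthonormal ℝ (fun σ => N σ w)
  span_eq : ∀ w ∈ cdisc, Submodule.span ℝ (Set.range fun σ => N σ w) = normalSpace X w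
  oriented : ∀ w ∈ cdisc,
    0 < (Matrix.of fun a b : Fin 4 => (![pd X 0 w, pd X 1 w, N 0 w, N 1 w] a) b).det

/-- The torsion coefficients: `torsion N σ θ i = T_{σ,i}^θ = N_{σ,uⁱ} · N_θ`. -/
def torsion (N : Fin 2 → ℂ → E4) (σ θ i : Fin 2) (w : ℂ) : ℝ :=
  inner ℝ (pd (N σ) i w) (N θ w)

/-- The curvature tensor of the normal bundle:
`normalCurvatureTensor N σ τ i j = S_{σ,ij}^τ
  = ∂_j T_{σ,i}^τ - ∂_i T_{σ,j}^τ + ∑_θ (T_{σ,i}^θ T_{θ,j}^τ - T_{σ,j}^θ T_{θ,i}^τ)`. -/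
def normalCurvatureTensor (N : Fin 2 → ℂ → E4) (σ τ i j : Fin 2) (w : ℂ) : ℝ :=
  pd (torsion N σ τ i) j w - pd (torsion N σ τ j) i w
    + ∑ θ : Fin 2, (torsion N σ θ i w * torsion N θ τ j w
        - torsion N σ θ j w * torsion N θ τ i w)

/-- The normal curvature `S_N = S_{1,12}^2 / W`. -/
def normalCurvature (X : ℂ → E4) (N : Fin 2 → ℂ → E4) (w : ℂ) : ℝ :=
  normalCurvatureTensor N 0 1 0 1 w / area X w

/-- The total torsion `∑_{i,j} ∑_{σ,θ} ∬_B g^{ij} T_{σ,i}^θ T_{σ,j}^θ W du dv`. -/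
def totalTorsion (X : ℂ → E4) (N : Fin 2 → ℂ → E4) : ℝ :=
  ∑ i : Fin 2, ∑ j : Fin 2, ∑ σ : Fin 2, ∑ θ : Fin 2,
    ∫ w in disc, (metric X w)⁻¹ i j * torsion N σ θ i w * torsion N σ θ j w * area X w

/-- The frame obtained from `N` by the rotation through the angle `φ`. -/
def rotate (φ : ℂ → ℝ) (N : Fin 2 → ℂ → E4) : Fin 2 → ℂ → E4 :=
  ![fun w => Real.cos (φ w) • N 0 w + Real.sin (φ w) • N 1 w,
    fun w => -Real.sin (φ w) • N 0 w + Real.cos (φ w) • N 1 w]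

/-- `N` is a normal Coulomb frame of `X`: a normal frame which is critical for the total torsion
with respect to all rotations by angles `ε φ`, with `φ` smooth up to the boundary. -/
structure IsCoulombFrame (k : ℕ) (α : ℝ≥0) (X : ℂ → E4) (N : Fin 2 → ℂ → E4) : Prop where
  isNormalFrame : IsNormalFrame k α X N
  critical : ∀ φ : ℂ → ℝ, ContDiffOn ℝ ∞ φ cdisc →
    HasDerivAt (fun ε : ℝ => totalTorsion X (rotate (fun w => ε * φ w) N)) 0 0

/-- The complex-valued torsion `Ψ = T_{1,1}^2 - i T_{1,2}^2`. -/
def complexTorsion (N : Fin 2 → ℂ → E4) (w : ℂ) : ℂ :=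
  (torsion N 0 1 0 w : ℂ) - Complex.I * (torsion N 0 1 1 w : ℂ)

end

end CoulombFrame

namespace CoulombFrame

/-! Write `a`, `b` for the two torsion coefficients of the frame and `Ψ = a - ib`. Rotating the
frame by `φ` adds `dφ` to `(a, b)` (`torsion_rotate`), and in conformal parameters the total torsion
is `2 ∬ (a² + b²)` (`totalTorsion_eq`). Criticality therefore says that `(a, b)` is orthogonal in
`L²` to all gradients: it is weakly divergence free with vanishing normal component on the circle
(`IsCoulombFrame.integral_eq_zero`). Since the normal bundle has rank two, the quadratic terms of
its curvature vanish and `S_N W = a_v - b_u` (`normalCurvature_mul_area`). So `Ψ` solves an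
inhomogeneous Cauchy–Riemann equation with a Riemann–Hilbert boundary condition.

Fix `w` and let `h` be a smoothed `1/(z - w)`, `R` the antiholomorphic kernel that equals `1/(z -
w)` on the circle. Test the weak equation with `-i(h + R)`, which needs no boundary condition, and
Green's identity with `h - R`, which vanishes on the circle. The sum leaves only an approximate
identity against `Ψ` on one side and `S_N W` against `h - R` on the other (`integral_mollifier_eq`).
As `|h - R| ≤ 2/|z - w|`, letting the smoothing tend to zero gives `π |Ψ(w)| ≤ ∬ |S_N W| / |z - w|`
(`pi_mul_norm_le`).

Hölder's inequality finishes: the exponent conjugate to `p > 2` is below `2`, so `1/|z - w|` has an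
`L^q` norm bounded uniformly in `w`. -/

lemma disc_subset_cdisc : disc ⊆ cdisc := ball_subset_closedBall

lemma measurableSet_disc : MeasurableSet disc := measurableSet_ball

lemma isCompact_cdisc : IsCompact cdisc := isCompact_closedBall 0 1

lemma uniqueDiffOn_cdisc : UniqueDiffOn ℝ cdisc :=
  uniqueDiffOn_convex (convex_closedBall 0 1)
    ⟨0, ball_subset_interior_closedBall (mem_ball_self one_pos)⟩

lemma cdisc_mem_nhds {w : ℂ} (hw : w ∈ disc) : cdisc ∈ nhds w :=
  Filter.mem_of_superset (isOpen_ball.mem_nhds hw) disc_subset_cdisc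

instance isFiniteMeasure_restrict_disc : IsFiniteMeasure (volume.restrict disc) :=
  isFiniteMeasure_restrict.mpr measure_ball_lt_top.ne

/-! ### Calculus up to the boundary of the disc -/

section pd

variable {F : Type*} [NormedAddCommGroup F]

lemma _root_.ContinuousOn.integrableOn_disc {f : ℂ → F} (hf : ContinuousOn f cdisc) :
    IntegrableOn f disc :=
  (hf.integrableOn_compact isCompact_cdisc).mono_set disc_subset_cdisc

variable [NormedSpace ℝ F]

lemma pd_eq_fderiv (f : ℂ → F) (i : Fin 2) {w : ℂ} (hw : w ∈ disc) :
    pd f i w = fderiv ℝ f w (dir i) := by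
  rw [pd, fderivWithin_of_mem_nhds (cdisc_mem_nhds hw)]

lemma contDiffOn_pd {f : ℂ → F} {m n : WithTop ℕ∞} (hf : ContDiffOn ℝ n f cdisc)
    (hmn : m + 1 ≤ n) (i : Fin 2) : ContDiffOn ℝ m (pd f i) cdisc :=
  (hf.fderivWithin uniqueDiffOn_cdisc hmn).clm_apply contDiffOn_const

lemma continuousOn_pd {f : ℂ → F} (hf : ContDiffOn ℝ 1 f cdisc) (i : Fin 2) :
    ContinuousOn (pd f i) cdisc :=
  (contDiffOn_pd (m := 0) hf (by simp) i).continuousOn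

end pd

/-! ### Torsion coefficients and rotations of the frame -/

section frame

variable {N : Fin 2 → ℂ → E4}

lemma contDiffOn_torsion (hN : ∀ σ, ContDiffOn ℝ 2 (N σ) cdisc) (σ θ i : Fin 2) :
    ContDiffOn ℝ 1 (torsion N σ θ i) cdisc :=
  (contDiffOn_pd (hN σ) (by norm_num [one_add_one_eq_two]) i).inner ℝ
    ((hN θ).of_le (by norm_num))

/-- Differentiate the constant function `N_σ · N_θ`. -/
lemma torsion_antisymm (hN : ∀ σ, DifferentiableOn ℝ (N σ) cdisc)
    (ho : ∀ w ∈ cdisc, Orthonormal ℝ fun σ => N σ w) (σ θ i : Fin 2) {w : ℂ} (hw : w ∈ cdisc) :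
    torsion N σ θ i w = -torsion N θ σ i w := by
  have h1 := ((hN σ w hw).hasFDerivWithinAt.inner ℝ (hN θ w hw).hasFDerivWithinAt).fderivWithin
    (uniqueDiffOn_cdisc w hw)
  have h2 : fderivWithin ℝ (fun w => inner ℝ (N σ w) (N θ w)) cdisc w = 0 := by
    rw [fderivWithin_congr (f := fun _ => if σ = θ then (1 : ℝ) else 0)
      (fun z hz => (orthonormal_iff_ite.mp (ho z hz)) σ θ)
      ((orthonormal_iff_ite.mp (ho w hw)) σ θ)]
    simp
  have h3 := DFunLike.congr_fun (h1.symm.trans h2) (dir i)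
  simp only [ContinuousLinearMap.comp_apply, ContinuousLinearMap.prod_apply,
    fderivInnerCLM_apply, zero_apply] at h3
  rw [torsion, torsion, pd, pd, real_inner_comm (N σ w)]
  linarith

lemma torsion_self (hN : ∀ σ, DifferentiableOn ℝ (N σ) cdisc)
    (ho : ∀ w ∈ cdisc, Orthonormal ℝ fun σ => N σ w) (σ i : Fin 2) {w : ℂ} (hw : w ∈ cdisc) :
    torsion N σ σ i w = 0 := by
  linarith [torsion_antisymm hN ho σ σ i hw]

lemma differentiableOn_rotate (hN : ∀ σ, DifferentiableOn ℝ (N σ) cdisc) {φ : ℂ → ℝ}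
    (hφ : DifferentiableOn ℝ φ cdisc) (σ : Fin 2) :
    DifferentiableOn ℝ (rotate φ N σ) cdisc := by
  have h0 := hN 0
  have h1 := hN 1
  fin_cases σ
  · exact (hφ.cos.smul h0).add (hφ.sin.smul h1)
  · exact (hφ.sin.neg.smul h0).add (hφ.cos.smul h1)

lemma orthonormal_rotate {w : ℂ} (ho : Orthonormal ℝ fun σ => N σ w) (φ : ℂ → ℝ) :
    Orthonormal ℝ fun σ => rotate φ N σ w := by
  rw [orthonormal_iff_ite] at ho ⊢
  have h00 := ho 0 0
  have h01 := ho 0 1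
  have h10 := ho 1 0
  have h11 := ho 1 1
  have hsc := Real.sin_sq_add_cos_sq (φ w)
  simp only [if_true, zero_ne_one, one_ne_zero, if_false] at h00 h01 h10 h11
  intro σ θ
  fin_cases σ <;> fin_cases θ <;>
    simp [rotate, inner_add_left, inner_add_right, inner_smul_left, inner_smul_right,
      h00, h01, h10, h11, -inner_self_eq_norm_sq_to_K] <;> nlinarith

/-- Rotations in the plane commute, so the torsion transforms like an abelian connection form: only
the derivative of the angle is added. -/
lemma torsion_rotate (hN : ∀ σ, DifferentiableOn ℝ (N σ) cdisc)
    (ho : ∀ w ∈ cdisc, Orthonormal ℝ fun σ => N σ w) {φ : ℂ → ℝ}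
    (hφ : DifferentiableOn ℝ φ cdisc) (i : Fin 2) {w : ℂ} (hw : w ∈ cdisc) :
    torsion (rotate φ N) 0 1 i w = torsion N 0 1 i w + pd φ i w := by
  have hφw := (hφ w hw).hasFDerivWithinAt
  have h := ((hφw.cos.smul (hN 0 w hw).hasFDerivWithinAt).add
    (hφw.sin.smul (hN 1 w hw).hasFDerivWithinAt)).fderivWithin (uniqueDiffOn_cdisc w hw)
  have hpd : pd (rotate φ N 0) i w = Real.cos (φ w) • pd (N 0) i w
      + (-Real.sin (φ w) * pd φ i w) • N 0 w
      + (Real.sin (φ w) • pd (N 1) i w + (Real.cos (φ w) * pd φ i w) • N 1 w) := by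
    refine (DFunLike.congr_fun h (dir i)).trans ?_
    simp [pd]
  have hon := orthonormal_iff_ite.mp (ho w hw)
  have h00 := hon 0 0
  have h01 := hon 0 1
  have h10 := hon 1 0
  have h11 := hon 1 1
  simp only [if_true, zero_ne_one, one_ne_zero, if_false] at h00 h01 h10 h11
  have t00 := torsion_self hN ho 0 i hw
  have t11 := torsion_self hN ho 1 i hw
  have t10 := torsion_antisymm hN ho 1 0 i hw
  have hsc := Real.sin_sq_add_cos_sq (φ w)
  have e1 : rotate φ N 1 w = -Real.sin (φ w) • N 0 w + Real.cos (φ w) • N 1 w := rfl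
  rw [torsion, hpd, e1]
  simp only [torsion] at t00 t11 t10 ⊢
  simp only [inner_add_left, inner_add_right, real_inner_smul_left, real_inner_smul_right,
    h00, h01, h10, h11, t00, t11, t10]
  linear_combination (inner ℝ (pd (N 0) i w) (N 1 w) + pd φ i w) * hsc

end frame

/-! ### Total torsion and normal curvature in conformal parameters -/

section immersion

variable {X : ℂ → E4} {N : Fin 2 → ℂ → E4}

lemma area_pos {k : ℕ} {α : ℝ≥0} (hX : IsImmersion k α X) (hc : IsConformal X) {w : ℂ}
    (hw : w ∈ cdisc) : 0 < area X w := by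
  rw [← (hc w hw).1]
  exact real_inner_self_pos.mpr ((hX.linearIndependent w hw).ne_zero 0)

lemma metric_eq_area_smul (hc : IsConformal X) {w : ℂ} (hw : w ∈ cdisc) :
    metric X w = area X w • (1 : Matrix (Fin 2) (Fin 2) ℝ) := by
  obtain ⟨h0, h1, h01⟩ := hc w hw
  have h10 : metric X w 1 0 = 0 := by
    rw [← h01]; exact real_inner_comm (pd X 0 w) (pd X 1 w)
  ext i j
  fin_cases i <;> fin_cases j <;> simp [h0, h1, h01, h10]

lemma metric_inv_mul_area {k : ℕ} {α : ℝ≥0} (hX : IsImmersion k α X) (hc : IsConformal X) {w : ℂ}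
    (hw : w ∈ cdisc) (i j : Fin 2) :
    (metric X w)⁻¹ i j * area X w = (1 : Matrix (Fin 2) (Fin 2) ℝ) i j := by
  have h := (area_pos hX hc hw).ne'
  have : (metric X w)⁻¹ = (area X w)⁻¹ • (1 : Matrix (Fin 2) (Fin 2) ℝ) := by
    apply Matrix.inv_eq_right_inv
    rw [metric_eq_area_smul hc hw]
    simp [h, smul_smul]
  rw [this, Matrix.smul_apply, smul_eq_mul]
  field_simp

/-- Conformality makes `g^{ij} W = δ_{ij}`, so the metric drops out. The factor `2` counts the pairs
`(σ, θ) = (1, 2)` and `(2, 1)`, equal up to sign. -/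
lemma totalTorsion_eq {k : ℕ} {α : ℝ≥0} (hX : IsImmersion k α X) (hc : IsConformal X)
    (hN : ∀ σ, DifferentiableOn ℝ (N σ) cdisc)
    (ho : ∀ w ∈ cdisc, Orthonormal ℝ fun σ => N σ w) :
    totalTorsion X N =
      2 * (∫ w in disc, torsion N 0 1 0 w ^ 2) + 2 * ∫ w in disc, torsion N 0 1 1 w ^ 2 := by
  have key : ∀ i j σ θ : Fin 2,
      ∫ w in disc, (metric X w)⁻¹ i j * torsion N σ θ i w * torsion N σ θ j w * area X w
        = if i = j then (if σ = θ then 0 else ∫ w in disc, torsion N 0 1 i w ^ 2) else 0 := by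
    intro i j σ θ
    have h1 : ∀ w ∈ disc,
        (metric X w)⁻¹ i j * torsion N σ θ i w * torsion N σ θ j w * area X w =
        if i = j then (if σ = θ then 0 else torsion N 0 1 i w ^ 2) else 0 := by
      intro w hw
      have hw' := disc_subset_cdisc hw
      have h2 := metric_inv_mul_area hX hc hw' i j
      have h3 : torsion N σ θ i w ^ 2 = if σ = θ then 0 else torsion N 0 1 i w ^ 2 := by
        split_ifs with h
        · subst h; simp [torsion_self hN ho σ i hw']
        · have := torsion_antisymm hN ho 1 0 i hw'
          fin_cases σ <;> fin_cases θ <;> simp_all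
      rw [← h3, mul_right_comm, mul_right_comm _ _ (area X w), h2, Matrix.one_apply]
      split_ifs with h
      · subst h; ring
      · simp
    rw [setIntegral_congr_fun measurableSet_disc h1]
    split_ifs <;> simp
  simp only [totalTorsion, key, Fin.sum_univ_two]
  simp
  ring

/-- Every quadratic term of the curvature tensor contains a factor `T_{σ,i}^σ`, which is zero. -/
lemma normalCurvature_mul_area {k : ℕ} {α : ℝ≥0} (hX : IsImmersion k α X) (hc : IsConformal X)
    (hN : ∀ σ, DifferentiableOn ℝ (N σ) cdisc)
    (ho : ∀ w ∈ cdisc, Orthonormal ℝ fun σ => N σ w) {w : ℂ} (hw : w ∈ cdisc) :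
    normalCurvature X N w * area X w
      = pd (torsion N 0 1 0) 1 w - pd (torsion N 0 1 1) 0 w := by
  rw [normalCurvature, div_mul_cancel₀ _ (area_pos hX hc hw).ne', normalCurvatureTensor]
  simp [Fin.sum_univ_two, torsion_self hN ho _ _ hw]

/-- The Euler–Lagrange equation of the total torsion in weak form, with natural boundary
condition. -/
lemma IsCoulombFrame.integral_eq_zero {k : ℕ} {α : ℝ≥0} (hX : IsImmersion k α X)
    (hc : IsConformal X) (hk : 3 ≤ k) (hN : IsCoulombFrame k α X N) {φ : ℂ → ℝ}
    (hφ : ContDiffOn ℝ ∞ φ cdisc) :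
    ∫ w in disc, (torsion N 0 1 0 w * pd φ 0 w + torsion N 0 1 1 w * pd φ 1 w) = 0 := by
  have hN2 : ∀ σ, ContDiffOn ℝ 2 (N σ) cdisc := fun σ =>
    (hN.isNormalFrame.smooth σ).1.of_le (by exact_mod_cast (by omega : 2 ≤ k - 1))
  have hNd : ∀ σ, DifferentiableOn ℝ (N σ) cdisc := fun σ =>
    (hN2 σ).differentiableOn (by norm_num)
  have ho := hN.isNormalFrame.orthonormal
  have hφ1 : ContDiffOn ℝ 1 φ cdisc := hφ.of_le (by exact_mod_cast le_top)
  have ha : ∀ i, ContinuousOn (torsion N 0 1 i) cdisc := fun i =>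
    (contDiffOn_torsion hN2 0 1 i).continuousOn
  have hp : ∀ i, ContinuousOn (pd φ i) cdisc := fun i => continuousOn_pd hφ1 i
  have hexp : ∀ (i : Fin 2) (ε : ℝ), ∫ w in disc, (torsion N 0 1 i w + ε * pd φ i w) ^ 2
      = (∫ w in disc, torsion N 0 1 i w ^ 2) + ε * (2 * ∫ w in disc, torsion N 0 1 i w * pd φ i w)
        + ε ^ 2 * ∫ w in disc, pd φ i w ^ 2 := by
    intro i ε
    have e : ∀ w, (torsion N 0 1 i w + ε * pd φ i w) ^ 2 = torsion N 0 1 i w ^ 2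
        + (2 * ε) * (torsion N 0 1 i w * pd φ i w) + ε ^ 2 * pd φ i w ^ 2 := fun w => by ring
    have i1 : IntegrableOn (fun w => torsion N 0 1 i w ^ 2) disc :=
      ((ha i).pow 2).integrableOn_disc
    have i2 : IntegrableOn (fun w => (2 * ε) * (torsion N 0 1 i w * pd φ i w)) disc :=
      (((ha i).mul (hp i)).integrableOn_disc).const_mul _
    have i3 : IntegrableOn (fun w => ε ^ 2 * pd φ i w ^ 2) disc :=
      (((hp i).pow 2).integrableOn_disc).const_mul _
    simp_rw [e]
    have i12 : IntegrableOn (fun w => torsion N 0 1 i w ^ 2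
      + (2 * ε) * (torsion N 0 1 i w * pd φ i w)) disc := i1.add i2
    rw [integral_add i12 i3, integral_add i1 i2, integral_const_mul, integral_const_mul]
    ring
  have hT : ∀ ε : ℝ, totalTorsion X (rotate (fun w => ε * φ w) N)
      = 2 * (∫ w in disc, (torsion N 0 1 0 w + ε * pd φ 0 w) ^ 2)
        + 2 * ∫ w in disc, (torsion N 0 1 1 w + ε * pd φ 1 w) ^ 2 := by
    intro ε
    have hφd := hφ1.differentiableOn (by norm_num)
    have hεφ : DifferentiableOn ℝ (fun w => ε * φ w) cdisc := hφd.const_mul ε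
    rw [totalTorsion_eq hX hc (differentiableOn_rotate hNd hεφ)
      (fun w hw => orthonormal_rotate (ho w hw) _)]
    have hpe : ∀ i : Fin 2, ∀ w ∈ disc, torsion (rotate (fun w => ε * φ w) N) 0 1 i w ^ 2
        = (torsion N 0 1 i w + ε * pd φ i w) ^ 2 := by
      intro i w hw
      have hw' := disc_subset_cdisc hw
      rw [torsion_rotate hNd ho hεφ i hw', pd, pd,
        fderivWithin_const_mul (uniqueDiffOn_cdisc w hw') (hφd w hw')]
      simp
    rw [setIntegral_congr_fun measurableSet_disc (hpe 0),
      setIntegral_congr_fun measurableSet_disc (hpe 1)]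
  have hcrit := hN.critical φ hφ
  simp_rw [hT, hexp] at hcrit
  -- The total torsion is a quadratic polynomial in `ε`; its derivative at `0` is the linear
  -- coefficient, here the cross terms.
  have hquad : ∀ A L Q : ℝ, HasDerivAt (fun ε : ℝ => A + ε * L + ε ^ 2 * Q) L 0 := by
    intro A L Q
    refine ((((hasDerivAt_id (0 : ℝ)).mul_const L).const_add A).add
      (((hasDerivAt_id (0 : ℝ)).pow 2).mul_const Q)).congr_deriv ?_
    simp
  have hu := hcrit.unique (((hquad _ _ _).const_mul 2).add ((hquad _ _ _).const_mul 2))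
  have i0 : ∀ i, IntegrableOn (fun w => torsion N 0 1 i w * pd φ i w) disc := fun i =>
    ((ha i).mul (hp i)).integrableOn_disc
  rw [integral_add (i0 0) (i0 1)]
  linarith

end immersion

/-! ### Integration by parts on the disc by means of cutoffs -/

/-- Integration by parts against the constant function `1`. -/
lemma integral_fderiv_apply_eq_zero {F : ℂ → ℂ} (hF : ContDiff ℝ 1 F) (hc : HasCompactSupport F)
    (v : ℂ) : ∫ x, fderiv ℝ F x v = 0 := by
  have hi : Integrable (fun x => fderiv ℝ F x v) :=
    ((hF.continuous_fderiv (by norm_num)).clm_apply continuous_const).integrable_of_hasCompactSupport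
      ((hc.fderiv (𝕜 := ℝ)).mono fun x hx => by
        contrapose! hx
        simp [Function.notMem_support.mp hx])
  have h := integral_bilinear_hasFDerivAt_right_eq_neg_left_of_integrable (μ := volume)
    (f := fun _ : ℂ => (1 : ℂ)) (f' := fun _ => 0) (g := F) (g' := fderiv ℝ F) (v := v)
    (B := ContinuousLinearMap.mul ℝ ℂ) (by simp) (by simpa using hi)
    (by simpa using hF.continuous.integrable_of_hasCompactSupport hc)
    (fun x _ => hasFDerivAt_const _ _)
    (fun x _ => (hF.differentiable (by norm_num) x).hasFDerivAt)
  simpa using h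

lemma hasDerivAt_smoothTransition (t : ℝ) :
    HasDerivAt Real.smoothTransition (deriv Real.smoothTransition t) t :=
  ((Real.smoothTransition.contDiff (n := 1)).differentiable (by norm_num) t).hasDerivAt

lemma continuous_deriv_smoothTransition : Continuous (deriv Real.smoothTransition) :=
  (Real.smoothTransition.contDiff (n := 1)).continuous_deriv (by norm_num)

lemma deriv_smoothTransition_nonneg (t : ℝ) : 0 ≤ deriv Real.smoothTransition t :=
  Real.smoothTransition.monotone.deriv_nonneg

lemma deriv_smoothTransition_of_neg {t : ℝ} (ht : t < 0) : deriv Real.smoothTransition t = 0 := by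
  have : Real.smoothTransition =ᶠ[nhds t] fun _ => 0 := by
    filter_upwards [Iio_mem_nhds ht] with s hs
    exact Real.smoothTransition.zero_of_nonpos (le_of_lt hs)
  simp [this.deriv_eq]

lemma deriv_smoothTransition_of_one_lt {t : ℝ} (ht : 1 < t) :
    deriv Real.smoothTransition t = 0 := by
  have : Real.smoothTransition =ᶠ[nhds t] fun _ => 1 := by
    filter_upwards [Ioi_mem_nhds ht] with s hs
    exact Real.smoothTransition.one_of_one_le (le_of_lt hs)
  simp [this.deriv_eq]

lemma exists_deriv_smoothTransition_le : ∃ M, ∀ t, deriv Real.smoothTransition t ≤ M := by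
  obtain ⟨M, hM⟩ := isCompact_Icc.bddAbove_image (K := Icc (0 : ℝ) 1)
    continuous_deriv_smoothTransition.continuousOn
  refine ⟨max M 0, fun t => ?_⟩
  rcases lt_or_ge t 0 with h | h
  · simp [deriv_smoothTransition_of_neg h]
  rcases lt_or_ge 1 t with h' | h'
  · simp [deriv_smoothTransition_of_one_lt h']
  · exact (hM ⟨t, ⟨h, h'⟩, rfl⟩).trans (le_max_left _ _)

/-- A cutoff which vanishes for `n (1 - |z|²) ≤ 1` and equals `1` for `n (1 - |z|²) ≥ 2`. -/
noncomputable def cutoff (n : ℕ) (z : ℂ) : ℝ := Real.smoothTransition (n * (1 - ‖z‖ ^ 2) - 1)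

lemma contDiff_cutoff (n : ℕ) : ContDiff ℝ 1 (cutoff n) :=
  (Real.smoothTransition.contDiff (n := 1)).comp
    ((contDiff_const.mul (contDiff_const.sub (contDiff_norm_sq ℝ))).sub contDiff_const)

lemma hasFDerivAt_cutoff (n : ℕ) (z : ℂ) :
    HasFDerivAt (cutoff n) (deriv Real.smoothTransition (n * (1 - ‖z‖ ^ 2) - 1) •
      ((n : ℝ) • (-((2 : ℕ) • (innerSL ℝ z : ℂ →L[ℝ] ℝ))))) z :=
  (hasDerivAt_smoothTransition _).comp_hasFDerivAt z
    ((((hasStrictFDerivAt_norm_sq z).hasFDerivAt.const_sub 1).const_mul (n : ℝ)).sub_const 1)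

lemma cutoff_eventuallyEq_zero {n : ℕ} {z : ℂ} (hz : 1 ≤ ‖z‖) : cutoff n =ᶠ[nhds z] 0 := by
  have h : ∀ᶠ y in nhds z, (n : ℝ) * (1 - ‖y‖ ^ 2) - 1 < 0 := by
    apply ContinuousAt.eventually_lt (by fun_prop) continuousAt_const
    have : (1 : ℝ) ≤ ‖z‖ ^ 2 := one_le_pow₀ hz
    nlinarith [n.cast_nonneg (α := ℝ)]
  filter_upwards [h] with y hy
  exact Real.smoothTransition.zero_of_nonpos hy.le

/-- Mean value inequality on the radial segment from `z` to the nearest point of the circle. This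
decay compensates the growth of order `n` of the gradient of `cutoff n`. -/
lemma exists_norm_le_mul_one_sub_norm {g : ℂ → ℂ} (hg : ContDiffOn ℝ 1 g cdisc)
    (h0 : ∀ z, ‖z‖ = 1 → g z = 0) : ∃ K : ℝ, 0 ≤ K ∧ ∀ z ∈ disc, ‖g z‖ ≤ K * (1 - ‖z‖) := by
  obtain ⟨C, hC⟩ := isCompact_cdisc.exists_bound_of_continuousOn
    (hg.continuousOn_fderivWithin uniqueDiffOn_cdisc le_rfl)
  refine ⟨max C 0, le_max_right _ _, fun z hz => ?_⟩
  have hz1 : ‖z‖ < 1 := by simpa [disc] using hz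
  obtain ⟨y, hy, hyz⟩ : ∃ y : ℂ, ‖y‖ = 1 ∧ ‖z - y‖ = 1 - ‖z‖ := by
    rcases eq_or_ne z 0 with rfl | hne
    · exact ⟨1, by simp, by simp⟩
    · have hn : ‖z‖ ≠ 0 := norm_ne_zero_iff.mpr hne
      refine ⟨(‖z‖⁻¹ : ℝ) • z, by rw [norm_smul]; simp [hn], ?_⟩
      have : z - (‖z‖⁻¹ : ℝ) • z = (1 - ‖z‖⁻¹ : ℝ) • z := by rw [sub_smul, one_smul]
      rw [this, norm_smul, Real.norm_eq_abs, abs_of_nonpos]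
      · field_simp; ring
      · rw [sub_nonpos]; exact (one_le_inv₀ (norm_pos_iff.mpr hne)).mpr hz1.le
  have hlip := (convex_closedBall (0 : ℂ) 1).norm_image_sub_le_of_norm_fderivWithin_le
    (𝕜 := ℝ) (hg.differentiableOn (by norm_num)) (fun x hx => (hC x hx).trans (le_max_left C 0))
    (x := y) (y := z) (mem_closedBall_zero_iff.mpr hy.le) (disc_subset_cdisc hz)
  rwa [h0 y hy, sub_zero, hyz] at hlip

lemma norm_dir (i : Fin 2) : ‖dir i‖ = 1 := by fin_cases i <;> simp [dir]

/-- The integral over the disc of a partial derivative of a function vanishing on the circle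
is zero. -/
theorem integral_pd_eq_zero {g : ℂ → ℂ} (hg : ContDiffOn ℝ 1 g cdisc)
    (h0 : ∀ z, ‖z‖ = 1 → g z = 0) (i : Fin 2) : ∫ z in disc, pd g i z = 0 := by
  have hgat : ∀ z ∈ disc, ContDiffAt ℝ 1 g z := fun z hz => hg.contDiffAt (cdisc_mem_nhds hz)
  have hsm : ∀ n, ContDiff ℝ 1 (fun z => cutoff n z • g z) := by
    intro n
    rw [contDiff_iff_contDiffAt]
    intro z
    rcases lt_or_ge ‖z‖ 1 with hz | hz
    · exact (contDiff_cutoff n).contDiffAt.smul (hgat z (by simpa [disc] using hz))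
    · have : (fun z => cutoff n z • g z) =ᶠ[nhds z] fun _ => 0 := by
        filter_upwards [cutoff_eventuallyEq_zero (n := n) hz] with y hy
        simp [hy]
      exact contDiffAt_const.congr_of_eventuallyEq this
  have hout : ∀ n z, z ∉ disc → fderiv ℝ (fun z => cutoff n z • g z) z (dir i) = 0 := by
    intro n z hz
    have hz' : 1 ≤ ‖z‖ := by simpa [disc] using hz
    have : (fun z => cutoff n z • g z) =ᶠ[nhds z] fun _ => 0 := by
      filter_upwards [cutoff_eventuallyEq_zero (n := n) hz'] with y hy
      simp [hy]
    rw [this.fderiv_eq]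
    simp
  have hzero : ∀ n, ∫ z in disc, fderiv ℝ (fun z => cutoff n z • g z) z (dir i) = 0 := by
    intro n
    rw [setIntegral_eq_integral_of_forall_compl_eq_zero (hout n)]
    refine integral_fderiv_apply_eq_zero (hsm n)
      (HasCompactSupport.of_support_subset_isCompact isCompact_cdisc fun z hz => ?_) _
    contrapose! hz
    have hz' : 1 ≤ ‖z‖ := (not_le.mp fun h => hz (mem_closedBall_zero_iff.mpr h)).le
    simp [(cutoff_eventuallyEq_zero (n := n) hz').self_of_nhds]
  have hform : ∀ n, ∀ z ∈ disc, fderiv ℝ (fun z => cutoff n z • g z) z (dir i) =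
      cutoff n z • pd g i z + (deriv Real.smoothTransition (n * (1 - ‖z‖ ^ 2) - 1) *
        (n * (-(2 * inner ℝ z (dir i))))) • g z := by
    intro n z hz
    have h : fderiv ℝ (fun z => cutoff n z • g z) z = _ := ((hasFDerivAt_cutoff n z).smul
      ((hgat z hz).differentiableAt (by norm_num)).hasFDerivAt).fderiv
    rw [h, pd_eq_fderiv g i hz]
    simp
    exact Or.inl (Or.inl (Or.inl (by ring)))
  obtain ⟨M, hM⟩ := exists_deriv_smoothTransition_le
  obtain ⟨K, hK0, hK⟩ := exists_norm_le_mul_one_sub_norm hg h0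
  obtain ⟨C, hC⟩ := isCompact_cdisc.exists_bound_of_continuousOn (continuousOn_pd hg i)
  have hM0 : 0 ≤ M := (deriv_smoothTransition_nonneg 0).trans (hM 0)
  -- Dominated convergence: the cutoffs tend to `1`, and the terms with a derivative of the cutoff
  -- stay bounded and vanish eventually at each point.
  have hlim : Filter.Tendsto
      (fun n => ∫ z in disc, fderiv ℝ (fun z => cutoff n z • g z) z (dir i)) Filter.atTop
      (nhds (∫ z in disc, pd g i z)) := by
    refine tendsto_integral_of_dominated_convergence (fun _ => C + M * 4 * K) (fun n => ?_)
      (integrable_const _) (fun n => ?_) ?_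
    · exact (((hsm n).continuous_fderiv (by norm_num)).clm_apply
        continuous_const).aestronglyMeasurable
    · refine (ae_restrict_iff' measurableSet_disc).mpr (.of_forall fun z hz => ?_)
      have hz1 : ‖z‖ < 1 := by simpa [disc] using hz
      have hz0 := norm_nonneg z
      rw [hform n z hz]
      refine (norm_add_le _ _).trans (add_le_add ?_ ?_)
      · rw [norm_smul, cutoff, Real.norm_eq_abs, abs_of_nonneg (Real.smoothTransition.nonneg _)]
        exact (mul_le_of_le_one_left (norm_nonneg _) (Real.smoothTransition.le_one _)).trans
          (hC z (disc_subset_cdisc hz))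
      -- The derivative of the cutoff lives where `n (1 - |z|²) ≤ 2`. There `n (1 - |z|) ≤ 2` as
      -- well, which absorbs the factor `n` in the gradient.
      · rcases lt_or_ge (1 : ℝ) (n * (1 - ‖z‖ ^ 2) - 1) with ht | ht
        · rw [deriv_smoothTransition_of_one_lt ht]
          simp only [zero_mul, zero_smul, norm_zero]
          positivity
        · have hin : |inner ℝ z (dir i)| ≤ 1 :=
            (abs_real_inner_le_norm _ _).trans (by rw [norm_dir, mul_one]; exact hz1.le)
          have hn : (0 : ℝ) ≤ n := n.cast_nonneg
          rw [norm_smul, Real.norm_eq_abs, abs_mul, abs_mul, abs_neg, abs_mul,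
            abs_of_nonneg (deriv_smoothTransition_nonneg _), Nat.abs_cast, abs_two]
          calc deriv Real.smoothTransition (n * (1 - ‖z‖ ^ 2) - 1)
                * (n * (2 * |inner ℝ z (dir i)|)) * ‖g z‖
              ≤ M * (n * (2 * 1)) * (K * (1 - ‖z‖)) := by
                gcongr
                · exact hM _
                · exact hK z hz
            _ = M * K * 2 * (n * (1 - ‖z‖)) := by ring
            _ ≤ M * K * 2 * 2 := by
                gcongr
                nlinarith [mul_nonneg hn (mul_nonneg hz0 (sub_nonneg.mpr hz1.le))]
            _ = M * 4 * K := by ring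
    · refine (ae_restrict_iff' measurableSet_disc).mpr (.of_forall fun z hz => ?_)
      have hz1 : ‖z‖ < 1 := by simpa [disc] using hz
      have hpos : 0 < 1 - ‖z‖ ^ 2 := by nlinarith [norm_nonneg z]
      refine tendsto_const_nhds.congr' ?_
      have hev : ∀ᶠ n : ℕ in Filter.atTop, 2 / (1 - ‖z‖ ^ 2) < n :=
        tendsto_natCast_atTop_atTop.eventually_gt_atTop _
      filter_upwards [hev] with n hn
      have ht : 1 < n * (1 - ‖z‖ ^ 2) - 1 := by
        rw [div_lt_iff₀ hpos] at hn; linarith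
      rw [hform n z hz, deriv_smoothTransition_of_one_lt ht, cutoff,
        Real.smoothTransition.one_of_one_le ht.le]
      simp
  simp_rw [hzero] at hlim
  exact tendsto_nhds_unique hlim tendsto_const_nhds

/-- Green's identity with a test function vanishing on the circle. -/
theorem integral_green {a b : ℂ → ℝ} (ha : ContDiffOn ℝ 1 a cdisc) (hb : ContDiffOn ℝ 1 b cdisc)
    {ψ : ℂ → ℂ} (hψ : ContDiffOn ℝ 1 ψ cdisc) (h0 : ∀ z, ‖z‖ = 1 → ψ z = 0) :
    ∫ z in disc, (a z • pd ψ 1 z - b z • pd ψ 0 z) =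
      -∫ z in disc, (pd a 1 z - pd b 0 z) • ψ z := by
  have hpd : ∀ {c : ℂ → ℝ}, ContDiffOn ℝ 1 c cdisc → ∀ i, ∀ z ∈ cdisc,
      pd (fun z => c z • ψ z) i z = c z • pd ψ i z + pd c i z • ψ z := by
    intro c hc i z hz
    rw [pd, pd, pd, fderivWithin_fun_smul (uniqueDiffOn_cdisc z hz)
      (hc.differentiableOn (by norm_num) z hz) (hψ.differentiableOn (by norm_num) z hz)]
    simp
  have h1 := integral_pd_eq_zero (g := fun z => a z • ψ z) (ha.smul hψ)
    (fun z hz => by simp [h0 z hz]) 1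
  have h2 := integral_pd_eq_zero (g := fun z => b z • ψ z) (hb.smul hψ)
    (fun z hz => by simp [h0 z hz]) 0
  have c1 : ∀ {c : ℂ → ℝ}, ContDiffOn ℝ 1 c cdisc → ∀ i,
      IntegrableOn (fun z => c z • pd ψ i z) disc := fun hc i =>
    (hc.continuousOn.smul (continuousOn_pd hψ i)).integrableOn_disc
  have c2 : ∀ {c : ℂ → ℝ}, ContDiffOn ℝ 1 c cdisc → ∀ i,
      IntegrableOn (fun z => pd c i z • ψ z) disc := fun hc i =>
    ((continuousOn_pd hc i).smul hψ.continuousOn).integrableOn_disc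
  rw [setIntegral_congr_fun measurableSet_disc
    (fun z hz => hpd ha 1 z (disc_subset_cdisc hz)), integral_add (c1 ha 1) (c2 ha 1)] at h1
  rw [setIntegral_congr_fun measurableSet_disc
    (fun z hz => hpd hb 0 z (disc_subset_cdisc hz)), integral_add (c1 hb 0) (c2 hb 0)] at h2
  simp_rw [sub_smul]
  rw [integral_sub (c1 ha 1) (c1 hb 0), integral_sub (c2 ha 1) (c2 hb 0)]
  linear_combination h1 - h2

/-! ### The regularized Cauchy kernel -/

/-- A smooth regularization of `1 / z` which agrees with it for `‖z‖ ^ 2 ≥ 2 ε ^ 2` and vanishes for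
`‖z‖ ≤ ε`. -/
noncomputable def cauchyReg (ε : ℝ) (z : ℂ) : ℂ :=
  Real.smoothTransition (‖z‖ ^ 2 / ε ^ 2 - 1) • z⁻¹

/-- An approximate identity: `2 * mollifier ε` is `∂_u + i ∂_v` of `cauchyReg ε`. -/
noncomputable def mollifier (ε : ℝ) (z : ℂ) : ℝ :=
  deriv Real.smoothTransition (‖z‖ ^ 2 / ε ^ 2 - 1) / ε ^ 2

lemma norm_cauchyReg_le (ε : ℝ) (z : ℂ) : ‖cauchyReg ε z‖ ≤ ‖z‖⁻¹ := by
  rw [cauchyReg, norm_smul, norm_inv, Real.norm_eq_abs,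
    abs_of_nonneg (Real.smoothTransition.nonneg _)]
  exact mul_le_of_le_one_left (by positivity) (Real.smoothTransition.le_one _)

lemma cauchyReg_eq_inv {ε : ℝ} (hε : 0 < ε) {z : ℂ} (hz : 2 * ε ≤ ‖z‖) :
    cauchyReg ε z = z⁻¹ := by
  rw [cauchyReg, Real.smoothTransition.one_of_one_le, one_smul]
  rw [le_sub_iff_add_le, le_div_iff₀ (by positivity)]
  nlinarith

lemma cauchyReg_eventuallyEq_zero {ε : ℝ} (hε : 0 < ε) : cauchyReg ε =ᶠ[nhds 0] fun _ => 0 := by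
  filter_upwards [ball_mem_nhds (0 : ℂ) hε] with z hz
  have hz' : ‖z‖ < ε := by simpa using hz
  rw [cauchyReg, Real.smoothTransition.zero_of_nonpos, zero_smul]
  rw [sub_nonpos, div_le_one (by positivity)]
  gcongr

lemma contDiff_cauchyReg {ε : ℝ} (hε : 0 < ε) : ContDiff ℝ ∞ (cauchyReg ε) := by
  rw [contDiff_iff_contDiffAt]
  intro z
  rcases eq_or_ne z 0 with rfl | hz
  · exact contDiffAt_const.congr_of_eventuallyEq (cauchyReg_eventuallyEq_zero hε)
  · have h : ContDiff ℝ ∞ fun z : ℂ => Real.smoothTransition (‖z‖ ^ 2 / ε ^ 2 - 1) :=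
      (Real.smoothTransition.contDiff (n := ⊤)).comp
        (((contDiff_norm_sq ℝ).div_const _).sub contDiff_const)
    exact h.contDiffAt.smul ((contDiffAt_inv ℂ hz).restrict_scalars ℝ)

/-- Away from the origin `∂_u + i ∂_v` kills the holomorphic factor `1/z` and sends `|z|²` to `2z`,
which cancels `1/z`. Near the origin both sides vanish. -/
lemma fderiv_cauchyReg {ε : ℝ} (hε : 0 < ε) (z : ℂ) :
    fderiv ℝ (cauchyReg ε) z 1 + Complex.I * fderiv ℝ (cauchyReg ε) z Complex.I
      = 2 * mollifier ε z := by
  rcases eq_or_ne z 0 with rfl | hz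
  · rw [(cauchyReg_eventuallyEq_zero hε).fderiv_eq, mollifier, deriv_smoothTransition_of_neg]
    · simp
    · simp
  · have h1 : HasFDerivAt (fun z : ℂ => Real.smoothTransition (‖z‖ ^ 2 / ε ^ 2 - 1))
        (deriv Real.smoothTransition (‖z‖ ^ 2 / ε ^ 2 - 1) •
          ((ε ^ 2)⁻¹ • ((2 : ℕ) • (innerSL ℝ z : ℂ →L[ℝ] ℝ)))) z := by
      simp_rw [div_eq_mul_inv]
      exact (hasDerivAt_smoothTransition _).comp_hasFDerivAt z
        (((hasStrictFDerivAt_norm_sq z).hasFDerivAt.mul_const _).sub_const 1)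
    have h2 : HasFDerivAt (fun z : ℂ => z⁻¹) _ z :=
      ((hasDerivAt_inv hz).hasFDerivAt).restrictScalars ℝ
    have h3 : fderiv ℝ (cauchyReg ε) z = _ := (h1.smul h2).fderiv
    rw [h3, mollifier]
    have hI : (Complex.I) ^ 2 = -1 := Complex.I_sq
    have hinn : (((inner ℝ z 1 : ℝ) : ℂ)) + Complex.I * ((inner ℝ z Complex.I : ℝ) : ℂ) = z := by
      rw [Complex.inner, Complex.inner]
      apply Complex.ext <;> simp
    simp
    generalize deriv Real.smoothTransition (‖z‖ ^ 2 / ε ^ 2 - 1) = d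
    generalize Real.smoothTransition (‖z‖ ^ 2 / ε ^ 2 - 1) = s
    rw [Complex.inner, Complex.inner] at hinn
    simp at hinn
    have hεc : (ε : ℂ) ≠ 0 := by exact_mod_cast hε.ne'
    field_simp
    linear_combination 2 * z * d * hinn - s * ε ^ 2 * hI

lemma mollifier_nonneg (ε : ℝ) (z : ℂ) : 0 ≤ mollifier ε z :=
  div_nonneg (deriv_smoothTransition_nonneg _) (sq_nonneg _)

lemma mollifier_eq_zero {ε : ℝ} (hε : 0 < ε) {z : ℂ} (hz : 2 * ε ≤ ‖z‖) : mollifier ε z = 0 := by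
  rw [mollifier, deriv_smoothTransition_of_one_lt, zero_div]
  rw [lt_sub_iff_add_lt, lt_div_iff₀ (by positivity)]
  nlinarith

lemma continuous_mollifier (ε : ℝ) : Continuous (mollifier ε) :=
  (continuous_deriv_smoothTransition.comp (by fun_prop)).div_const _

lemma integrable_mollifier {ε : ℝ} (hε : 0 < ε) : Integrable (mollifier ε) :=
  (continuous_mollifier ε).integrable_of_hasCompactSupport
    (HasCompactSupport.of_support_subset_isCompact (isCompact_closedBall 0 (2 * ε)) fun z hz => by
      contrapose! hz
      have : 2 * ε ≤ ‖z‖ := by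
        by_contra! h
        exact hz (by simpa using h.le)
      simp [mollifier_eq_zero hε this])

/-- In polar coordinates the integrand `r · mollifier` is the derivative of half the transition
function, so the radial integral is `1/2` and the angle contributes `2π`. -/
lemma integral_mollifier {ε : ℝ} (hε : 0 < ε) : ∫ z, mollifier ε z = Real.pi := by
  have h := integral_fun_norm_addHaar (volume : Measure ℂ)
    (fun r => deriv Real.smoothTransition (r ^ 2 / ε ^ 2 - 1) / ε ^ 2)
  have hd : ∀ r : ℝ, HasDerivAt (fun r => Real.smoothTransition (r ^ 2 / ε ^ 2 - 1) / 2)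
      (r * (deriv Real.smoothTransition (r ^ 2 / ε ^ 2 - 1) / ε ^ 2)) r := by
    intro r
    have := ((hasDerivAt_smoothTransition (r ^ 2 / ε ^ 2 - 1)).comp r
      ((((hasDerivAt_id r).pow 2).div_const (ε ^ 2)).sub_const 1)).div_const 2
    refine this.congr_deriv ?_
    simp
    ring
  have hlim : Filter.Tendsto (fun r : ℝ => Real.smoothTransition (r ^ 2 / ε ^ 2 - 1) / 2)
      Filter.atTop (nhds (1 / 2)) := by
    refine tendsto_const_nhds.congr' ?_
    filter_upwards [Filter.eventually_ge_atTop (2 * ε)] with r hr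
    rw [Real.smoothTransition.one_of_one_le]
    rw [le_sub_iff_add_le, le_div_iff₀ (by positivity)]
    nlinarith
  have hF := integral_Ioi_of_hasDerivAt_of_nonneg' (a := 0) (fun r _ => hd r)
    (fun r hr => mul_nonneg (le_of_lt hr)
      (div_nonneg (deriv_smoothTransition_nonneg _) (sq_nonneg ε))) hlim
  have hS : Real.smoothTransition ((0 : ℝ) ^ 2 / ε ^ 2 - 1) = 0 :=
    Real.smoothTransition.zero_of_nonpos (by norm_num)
  rw [hS] at hF
  simp only [mollifier]
  rw [h]
  simp [measureReal_def, hF]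
  ring

/-! ### The reflected kernel -/

/-- The reflected Cauchy kernel with pole outside the closed disc. -/
noncomputable def reflKernel (w z : ℂ) : ℂ :=
  (starRingEnd ℂ) z / (1 - w * (starRingEnd ℂ) z)

lemma one_sub_mul_conj_ne_zero {w z : ℂ} (hw : w ∈ disc) (hz : z ∈ cdisc) :
    1 - w * (starRingEnd ℂ) z ≠ 0 := by
  have hw' : ‖w‖ < 1 := by simpa [disc] using hw
  have hz' : ‖z‖ ≤ 1 := mem_closedBall_zero_iff.mp hz
  intro h
  have : ‖w * (starRingEnd ℂ) z‖ = 1 := by rw [← sub_eq_zero.mp h, norm_one]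
  rw [norm_mul, RCLike.norm_conj] at this
  nlinarith [norm_nonneg w, norm_nonneg z]

lemma contDiffOn_reflKernel {w : ℂ} (hw : w ∈ disc) : ContDiffOn ℝ ∞ (reflKernel w) cdisc := by
  have hc : ContDiffOn ℝ ∞ (starRingEnd ℂ : ℂ → ℂ) cdisc :=
    Complex.conjCLE.contDiff.contDiffOn
  have hd : ContDiffOn ℝ ∞ (fun z => 1 - w * (starRingEnd ℂ) z) cdisc :=
    contDiffOn_const.sub (contDiffOn_const.mul hc)
  exact hc.mul (hd.inv fun z hz => one_sub_mul_conj_ne_zero hw hz)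

/-- `reflKernel w` is a holomorphic function of the conjugate of `z`, hence antiholomorphic. -/
lemma fderiv_reflKernel {w z : ℂ} (hw : w ∈ disc) (hz : z ∈ disc) :
    fderiv ℝ (reflKernel w) z 1 = Complex.I * fderiv ℝ (reflKernel w) z Complex.I := by
  have hd : DifferentiableAt ℂ (fun y : ℂ => y / (1 - w * y)) ((starRingEnd ℂ) z) := by
    have := one_sub_mul_conj_ne_zero hw (disc_subset_cdisc hz)
    fun_prop (disch := assumption)
  have h : fderiv ℝ (reflKernel w) z = _ :=
    (hd.hasDerivAt.hasFDerivAt.restrictScalars ℝ).comp z Complex.conjCLE.hasFDerivAt |>.fderiv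
  rw [h]
  simp
  generalize deriv (fun y : ℂ => y / (1 - w * y)) ((starRingEnd ℂ) z) = d
  linear_combination d * Complex.I_sq

lemma norm_reflKernel_le {w z : ℂ} (hz : z ∈ disc) :
    ‖reflKernel w z‖ ≤ ‖1 - w * (starRingEnd ℂ) z‖⁻¹ := by
  have hz' : ‖z‖ ≤ 1 := mem_closedBall_zero_iff.mp (disc_subset_cdisc hz)
  rw [reflKernel, norm_div, RCLike.norm_conj, ← one_div]
  gcongr

/-- The difference of the squares is `(1 - |z|²)(1 - |w|²)`. So the reflected kernel is no more
singular than `1/(z - w)`. -/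
lemma norm_sub_le_norm_one_sub_mul_conj {w z : ℂ} (hw : w ∈ disc) (hz : z ∈ disc) :
    ‖z - w‖ ≤ ‖1 - w * (starRingEnd ℂ) z‖ := by
  have hw' : ‖w‖ ≤ 1 := mem_closedBall_zero_iff.mp (disc_subset_cdisc hw)
  have hz' : ‖z‖ ≤ 1 := mem_closedBall_zero_iff.mp (disc_subset_cdisc hz)
  rw [← sq_le_sq₀ (norm_nonneg _) (norm_nonneg _)]
  have hw2 : ‖w‖ ^ 2 ≤ 1 := pow_le_one₀ (norm_nonneg _) hw'
  have hz2 : ‖z‖ ^ 2 ≤ 1 := pow_le_one₀ (norm_nonneg _) hz'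
  rw [← Complex.normSq_eq_norm_sq, Complex.normSq_apply] at *
  rw [← Complex.normSq_eq_norm_sq, Complex.normSq_apply] at *
  simp at *
  nlinarith [mul_nonneg (sub_nonneg.mpr hw2) (sub_nonneg.mpr hz2)]

/-- On the circle the conjugate of `z` is `1/z`. This is what makes the difference of the two
kernels an admissible test function in `integral_green`. -/
lemma inv_sub_eq_reflKernel {w z : ℂ} (hw : w ∈ disc) (hz : ‖z‖ = 1) :
    (z - w)⁻¹ = reflKernel w z := by
  have h1 : (starRingEnd ℂ) z * z = 1 := by
    rw [mul_comm, Complex.mul_conj, Complex.normSq_eq_norm_sq, hz]; simp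
  have h2 := one_sub_mul_conj_ne_zero hw (z := z) (mem_closedBall_zero_iff.mpr hz.le)
  have h3 : z - w ≠ 0 := by
    rintro h
    have hw' : ‖w‖ < 1 := by simpa [disc] using hw
    rw [sub_eq_zero.mp h] at hz
    linarith
  rw [reflKernel]
  field_simp
  linear_combination -h1

/-! ### Representation and pointwise estimate of the weak solution -/

section weak

variable {a b : ℂ → ℝ}

/-- The Cauchy kernels are complex valued, so the real weak equation is applied to real and
imaginary parts separately. -/
lemma integral_smul_pd_eq_zero (ha : ContDiffOn ℝ 1 a cdisc) (hb : ContDiffOn ℝ 1 b cdisc)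
    (hweak : ∀ φ : ℂ → ℝ, ContDiffOn ℝ ∞ φ cdisc →
      ∫ z in disc, (a z * pd φ 0 z + b z * pd φ 1 z) = 0)
    {φ : ℂ → ℂ} (hφ : ContDiffOn ℝ ∞ φ cdisc) :
    ∫ z in disc, (a z • pd φ 0 z + b z • pd φ 1 z) = 0 := by
  have hφ1 : ContDiffOn ℝ 1 φ cdisc := hφ.of_le (by exact_mod_cast le_top)
  have hint : IntegrableOn (fun z => a z • pd φ 0 z + b z • pd φ 1 z) disc :=
    ((ha.continuousOn.smul (continuousOn_pd hφ1 0)).add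
      (hb.continuousOn.smul (continuousOn_pd hφ1 1))).integrableOn_disc
  have hL : ∀ L : ℂ →L[ℝ] ℝ, L (∫ z in disc, (a z • pd φ 0 z + b z • pd φ 1 z)) = 0 := by
    intro L
    rw [← L.integral_comp_comm hint, ← hweak (fun z => L (φ z)) (L.contDiff.comp_contDiffOn hφ)]
    refine setIntegral_congr_fun measurableSet_disc fun z hz => ?_
    have hz' := disc_subset_cdisc hz
    have hpd : ∀ i, pd (fun z => L (φ z)) i z = L (pd φ i z) := fun i =>
      DFunLike.congr_fun (L.hasFDerivAt.comp_hasFDerivWithinAt z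
        (hφ1.differentiableOn (by norm_num) z hz').hasFDerivWithinAt |>.fderivWithin
          (uniqueDiffOn_cdisc z hz')) (dir i)
    simp only [hpd, map_add, map_smul, smul_eq_mul]
  exact Complex.ext (hL Complex.reCLM) (hL Complex.imCLM)

/-- The mollified solution of the Riemann–Hilbert problem is represented by the regularized
gradient of Green's function of the disc. -/
lemma integral_mollifier_eq (ha : ContDiffOn ℝ 1 a cdisc) (hb : ContDiffOn ℝ 1 b cdisc)
    (hweak : ∀ φ : ℂ → ℝ, ContDiffOn ℝ ∞ φ cdisc →
      ∫ z in disc, (a z * pd φ 0 z + b z * pd φ 1 z) = 0)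
    {w : ℂ} (hw : w ∈ disc) {ε : ℝ} (hε : 0 < ε) (hεw : 2 * ε ≤ 1 - ‖w‖) :
    2 * Complex.I * ∫ z in disc, mollifier ε (z - w) • ((a z : ℂ) - Complex.I * b z) =
      ∫ z in disc, (pd a 1 z - pd b 0 z) • (cauchyReg ε (z - w) - reflKernel w z) := by
  have hh : ContDiffOn ℝ ∞ (fun z => cauchyReg ε (z - w)) cdisc :=
    ((contDiff_cauchyReg hε).comp (contDiff_id.sub contDiff_const)).contDiffOn
  have hR := contDiffOn_reflKernel hw
  have hψ : ContDiffOn ℝ ∞ (fun z => cauchyReg ε (z - w) - reflKernel w z) cdisc := hh.sub hR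
  have hψ1 : ContDiffOn ℝ 1 (fun z => cauchyReg ε (z - w) - reflKernel w z) cdisc :=
    hψ.of_le (by exact_mod_cast le_top)
  have hφ : ContDiffOn ℝ ∞
      (fun z => -Complex.I * (cauchyReg ε (z - w) + reflKernel w z)) cdisc :=
    contDiffOn_const.mul (hh.add hR)
  have hφ1 : ContDiffOn ℝ 1
      (fun z => -Complex.I * (cauchyReg ε (z - w) + reflKernel w z)) cdisc :=
    hφ.of_le (by exact_mod_cast le_top)
  have hgreen := integral_green ha hb hψ1 fun z hz => by
    rw [cauchyReg_eq_inv hε, inv_sub_eq_reflKernel hw hz, sub_self]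
    have := norm_sub_norm_le z w
    linarith
  have hel := integral_smul_pd_eq_zero ha hb hweak hφ
  -- With `∂_u h + i ∂_v h = 2 · mollifier` and `∂_u R = i ∂_v R`, all derivatives of `R` cancel
  -- between the two test functions and those of `h` combine into the mollifier.
  have hpt : ∀ z ∈ disc,
      (a z • pd (fun z => -Complex.I * (cauchyReg ε (z - w) + reflKernel w z)) 0 z
        + b z • pd (fun z => -Complex.I * (cauchyReg ε (z - w) + reflKernel w z)) 1 z)
      + (a z • pd (fun z => cauchyReg ε (z - w) - reflKernel w z) 1 z
        - b z • pd (fun z => cauchyReg ε (z - w) - reflKernel w z) 0 z)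
      = (-(2 * Complex.I)) * (mollifier ε (z - w) • ((a z : ℂ) - Complex.I * b z)) := by
    intro z hz
    have dh : DifferentiableAt ℝ (fun z => cauchyReg ε (z - w)) z :=
      (hh.contDiffAt (cdisc_mem_nhds hz)).differentiableAt (by simp)
    have dR : DifferentiableAt ℝ (reflKernel w) z :=
      (hR.contDiffAt (cdisc_mem_nhds hz)).differentiableAt (by simp)
    have e1 := fderiv_cauchyReg hε (z - w)
    have e2 := fderiv_reflKernel hw hz
    have dφ : ∀ v, fderiv ℝ (fun z => -Complex.I * (cauchyReg ε (z - w) + reflKernel w z)) z v =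
        -Complex.I * (fderiv ℝ (cauchyReg ε) (z - w) v + fderiv ℝ (reflKernel w) z v) := by
      intro v
      rw [← fderiv_comp_sub,
        ((dh.hasFDerivAt.fun_add dR.hasFDerivAt).const_mul (-Complex.I)).fderiv]
      simp
      ring
    have dψ : ∀ v, fderiv ℝ (fun z => cauchyReg ε (z - w) - reflKernel w z) z v =
        fderiv ℝ (cauchyReg ε) (z - w) v - fderiv ℝ (reflKernel w) z v := by
      intro v
      rw [← fderiv_comp_sub, (dh.hasFDerivAt.fun_sub dR.hasFDerivAt).fderiv]
      simp
    simp only [pd_eq_fderiv _ _ hz, dφ, dψ, dir, Matrix.cons_val_zero, Matrix.cons_val_one,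
      Complex.real_smul]
    linear_combination (-Complex.I * a z - b z) * e1 + (-Complex.I * a z + b z) * e2
      + (a z * (fderiv ℝ (cauchyReg ε) (z - w) Complex.I - fderiv ℝ (reflKernel w) z Complex.I)
        - 2 * b z * mollifier ε (z - w)) * Complex.I_sq
  have i1 : IntegrableOn (fun z =>
      (a z • pd (fun z => -Complex.I * (cauchyReg ε (z - w) + reflKernel w z)) 0 z
        + b z • pd (fun z => -Complex.I * (cauchyReg ε (z - w) + reflKernel w z)) 1 z)) disc :=
    ((ha.continuousOn.smul (continuousOn_pd hφ1 0)).add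
      (hb.continuousOn.smul (continuousOn_pd hφ1 1))).integrableOn_disc
  have i2 : IntegrableOn (fun z =>
      (a z • pd (fun z => cauchyReg ε (z - w) - reflKernel w z) 1 z
        - b z • pd (fun z => cauchyReg ε (z - w) - reflKernel w z) 0 z)) disc :=
    ((ha.continuousOn.smul (continuousOn_pd hψ1 1)).sub
      (hb.continuousOn.smul (continuousOn_pd hψ1 0))).integrableOn_disc
  have hsum := integral_add i1 i2
  rw [setIntegral_congr_fun measurableSet_disc hpt, integral_const_mul, hel, hgreen] at hsum
  linear_combination -hsum

lemma norm_kernel_le {w z : ℂ} (hw : w ∈ disc) (hz : z ∈ disc) (hne : z ≠ w) (ε : ℝ) :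
    ‖cauchyReg ε (z - w) - reflKernel w z‖ ≤ 2 * ‖z - w‖⁻¹ := by
  have h0 : 0 < ‖z - w‖ := norm_pos_iff.mpr (sub_ne_zero.mpr hne)
  have h1 := norm_cauchyReg_le ε (z - w)
  have h2 := (norm_reflKernel_le (w := w) hz).trans
    (inv_anti₀ h0 (norm_sub_le_norm_one_sub_mul_conj hw hz))
  linarith [norm_sub_le (cauchyReg ε (z - w)) (reflKernel w z)]

/-- Pointwise estimate of a weak solution of `div (a, b) = 0` with vanishing normal component on the
circle by the singular integral of its curl. -/
theorem pi_mul_norm_le (ha : ContDiffOn ℝ 1 a cdisc) (hb : ContDiffOn ℝ 1 b cdisc)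
    (hweak : ∀ φ : ℂ → ℝ, ContDiffOn ℝ ∞ φ cdisc →
      ∫ z in disc, (a z * pd φ 0 z + b z * pd φ 1 z) = 0)
    {w : ℂ} (hw : w ∈ disc)
    (hint : IntegrableOn (fun z => (pd a 1 z - pd b 0 z) * ‖z - w‖⁻¹) disc) :
    Real.pi * ‖(a w : ℂ) - Complex.I * b w‖ ≤
      ∫ z in disc, ‖(pd a 1 z - pd b 0 z) * ‖z - w‖⁻¹‖ := by
  set Ψ : ℂ → ℂ := fun z => (a z : ℂ) - Complex.I * b z with hΨ
  have hΨc : ContinuousOn Ψ cdisc :=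
    (Complex.continuous_ofReal.comp_continuousOn ha.continuousOn).sub
      (continuousOn_const.mul (Complex.continuous_ofReal.comp_continuousOn hb.continuousOn))
  have hw1 : ‖w‖ < 1 := by simpa [disc] using hw
  refine le_of_forall_pos_le_add fun δ hδ => ?_
  obtain ⟨r, hr, hball⟩ := Metric.continuousAt_iff.mp
    (hΨc.continuousAt (cdisc_mem_nhds hw)) (δ / Real.pi) (by positivity)
  -- The mollifier about `w` has support of radius at most `2ε`: below `r` for the continuity of `Ψ`
  -- at `w`, below `1 - |w|` to stay in the disc and leave the kernel unchanged on the circle.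
  obtain ⟨ε, hε, hε2⟩ : ∃ ε : ℝ, 0 < ε ∧ 2 * ε ≤ min r (1 - ‖w‖) :=
    ⟨min r (1 - ‖w‖) / 2, by have := lt_min hr (sub_pos.mpr hw1); positivity, by linarith⟩
  have hεr := hε2.trans (min_le_left _ _)
  have hεw := hε2.trans (min_le_right _ _)
  have hsupp : ∀ z, z ∉ disc → mollifier ε (z - w) = 0 := by
    intro z hz
    have hz' : 1 ≤ ‖z‖ := by simpa [disc] using hz
    exact mollifier_eq_zero hε (by linarith [norm_sub_norm_le z w])
  have hmi : ∫ z in disc, mollifier ε (z - w) = Real.pi := by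
    rw [setIntegral_eq_integral_of_forall_compl_eq_zero hsupp,
      integral_sub_right_eq_self (mollifier ε) w, integral_mollifier hε]
  have hmint : IntegrableOn (fun z => mollifier ε (z - w)) disc :=
    ((integrable_mollifier hε).comp_sub_right w).integrableOn
  have hmc : ContinuousOn (fun z => mollifier ε (z - w)) cdisc :=
    ((continuous_mollifier ε).comp (continuous_id.sub continuous_const)).continuousOn
  have hrep := integral_mollifier_eq ha hb hweak hw hε hεw
  have hbound : ‖∫ z in disc, (pd a 1 z - pd b 0 z) • (cauchyReg ε (z - w) - reflKernel w z)‖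
      ≤ 2 * ∫ z in disc, ‖(pd a 1 z - pd b 0 z) * ‖z - w‖⁻¹‖ := by
    rw [← integral_const_mul]
    refine norm_integral_le_of_norm_le (hint.norm.const_mul 2) ?_
    have hne : ∀ᵐ z ∂(volume.restrict disc), z ≠ w :=
      ae_restrict_of_ae (compl_mem_ae_iff.mpr (measure_singleton w))
    filter_upwards [hne, ae_restrict_mem measurableSet_disc] with z hzw hz
    rw [norm_smul, norm_mul, norm_inv, norm_norm]
    calc _ ≤ ‖pd a 1 z - pd b 0 z‖ * (2 * ‖z - w‖⁻¹) := by
          gcongr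
          exact norm_kernel_le hw hz hzw ε
      _ = _ := by ring
  have hmain : ‖∫ z in disc, mollifier ε (z - w) • Ψ z‖
      ≤ ∫ z in disc, ‖(pd a 1 z - pd b 0 z) * ‖z - w‖⁻¹‖ := by
    rw [← hrep, norm_mul] at hbound
    simp only [norm_mul, Complex.norm_I, Complex.norm_ofNat, mul_one] at hbound ⊢
    linarith
  have hdiff : ‖∫ z in disc, mollifier ε (z - w) • (Ψ w - Ψ z)‖ ≤ δ := by
    have : δ = ∫ z in disc, mollifier ε (z - w) * (δ / Real.pi) := by
      rw [integral_mul_const, hmi, mul_div_cancel₀ _ Real.pi_ne_zero]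
    rw [this]
    refine norm_integral_le_of_norm_le (hmint.mul_const _) (.of_forall fun z => ?_)
    rw [norm_smul, Real.norm_eq_abs, abs_of_nonneg (mollifier_nonneg _ _)]
    rcases lt_or_ge ‖z - w‖ (2 * ε) with h | h
    · have := hball (x := z) (by rw [dist_eq_norm]; linarith)
      rw [dist_comm, dist_eq_norm] at this
      exact mul_le_mul_of_nonneg_left this.le (mollifier_nonneg _ _)
    · simp [mollifier_eq_zero hε h]
  have hsplit : (Real.pi : ℝ) • Ψ w = (∫ z in disc, mollifier ε (z - w) • Ψ z)
      + ∫ z in disc, mollifier ε (z - w) • (Ψ w - Ψ z) := by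
    have hm1 : IntegrableOn (fun z => mollifier ε (z - w) • Ψ z) disc :=
      (hmc.smul hΨc).integrableOn_disc
    have hm2 : IntegrableOn (fun z => mollifier ε (z - w) • (Ψ w - Ψ z)) disc :=
      (hmc.smul (continuousOn_const.sub hΨc)).integrableOn_disc
    rw [← integral_add hm1 hm2, ← hmi, ← integral_smul_const]
    congr 1 with z
    rw [← smul_add, add_sub_cancel]
  calc Real.pi * ‖Ψ w‖ = ‖(Real.pi : ℝ) • Ψ w‖ := by
        rw [norm_smul, Real.norm_eq_abs, abs_of_pos Real.pi_pos]
    _ ≤ _ := by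
        rw [hsplit]
        exact (norm_add_le _ _).trans (add_le_add hmain hdiff)

end weak

/-! ### Integrability of the singular kernel -/

/-- In polar coordinates this is the integrability of `t^(1 - q)` near `0`. -/
lemma memLp_inv_norm_ball {q : ℝ≥0∞} (hq0 : q ≠ 0) (hq : q < 2) (r : ℝ) :
    MemLp (fun z : ℂ => ‖z‖⁻¹) q (volume.restrict (ball 0 r)) := by
  have hqt : q ≠ ⊤ := (hq.trans ENNReal.ofNat_lt_top).ne
  have hq2 : q.toReal < 2 := by
    rw [← ENNReal.toReal_ofNat]
    exact (ENNReal.toReal_lt_toReal hqt ENNReal.ofNat_ne_top).mpr hq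
  rw [← integrable_norm_rpow_iff (by fun_prop) hq0 hqt]
  have h := (integrableOn_fun_norm_addHaar (volume : Measure ℂ)
    (f := fun t : ℝ => t⁻¹ ^ q.toReal) (r := r)).mpr ?_
  · simpa [IntegrableOn] using h
  · rcases le_or_gt r 0 with hr | hr
    · simp [Ioo_eq_empty (not_lt.mpr hr)]
    have hi : IntegrableOn (fun t : ℝ => t ^ (1 - q.toReal)) (Ioo 0 r) :=
      (intervalIntegral.integrableOn_Ioo_rpow_iff hr).mpr (by linarith)
    refine hi.congr_fun (fun t ht => ?_) measurableSet_Ioo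
    simp only [Complex.finrank_real_complex, smul_eq_mul]
    rw [Real.inv_rpow ht.1.le, Real.rpow_sub ht.1, Real.rpow_one]
    simp [div_eq_mul_inv]

/-- Translation by `w` carries the disc into the ball of radius `2`, so the bound does not depend on
`w`. -/
lemma eLpNorm_inv_norm_sub_le {w : ℂ} (hw : w ∈ disc) (q : ℝ≥0∞) :
    eLpNorm (fun z : ℂ => ‖z - w‖⁻¹) q (volume.restrict disc) ≤
      eLpNorm (fun z : ℂ => ‖z‖⁻¹) q (volume.restrict (ball 0 2)) := by
  have hw1 : ‖w‖ < 1 := by simpa [disc] using hw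
  have hmp := (measurePreserving_sub_right volume w).restrict_preimage
    (measurableSet_ball (x := (0 : ℂ)) (ε := 2))
  rw [← eLpNorm_comp_measurePreserving (by fun_prop) hmp]
  refine eLpNorm_mono_measure _ (Measure.restrict_mono (fun z hz => ?_) le_rfl)
  have hz1 : ‖z‖ < 1 := by simpa [disc] using hz
  rw [mem_preimage, mem_ball_zero_iff]
  linarith [norm_sub_le z w]

end CoulombFrame

/-! ### Conclusion by Hölder's inequality -/

open CoulombFrame in
theorem mainTheorem4 (p : ℝ≥0∞) (hp : 2 < p) :
    ∃ c : ℝ, 0 < c ∧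
      ∀ (k : ℕ) (α : ℝ≥0) (X : ℂ → CoulombFrame.E4) (N : Fin 2 → ℂ → CoulombFrame.E4),
        3 ≤ k → 0 < α → α < 1 →
        CoulombFrame.IsImmersion k α X →
        CoulombFrame.IsConformal X →
        CoulombFrame.IsCoulombFrame k α X N →
        MemLp (fun w => CoulombFrame.normalCurvature X N w * CoulombFrame.area X w) p
            (volume.restrict CoulombFrame.disc) ∧
          ∀ w ∈ CoulombFrame.disc,
            ‖CoulombFrame.complexTorsion N w‖ ≤
              c * (eLpNorm (fun z => CoulombFrame.normalCurvature X N z * CoulombFrame.area X z) p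
                (volume.restrict CoulombFrame.disc)).toReal := by
  -- `q` is the exponent conjugate to `p`; `p = ∞` gives `q = 1`.
  obtain ⟨q, hpq, hq0, hq2⟩ : ∃ q : ℝ≥0∞, ENNReal.HolderTriple p q 1 ∧ q ≠ 0 ∧ q < 2 := by
    have hp1 : p⁻¹ < 2⁻¹ := ENNReal.inv_lt_inv.mpr hp
    have hlt : 2⁻¹ < 1 - p⁻¹ := by
      rw [lt_tsub_iff_right, ← ENNReal.inv_two_add_inv_two]
      exact ENNReal.add_lt_add_left (by simp) hp1
    refine ⟨(1 - p⁻¹)⁻¹, ENNReal.holderConjugate_iff.mpr ?_, ?_, ?_⟩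
    · rw [inv_inv, add_tsub_cancel_of_le]
      exact hp1.le.trans (by simp)
    · exact ENNReal.inv_ne_zero.mpr (ENNReal.sub_ne_top ENNReal.one_ne_top)
    · rwa [ENNReal.inv_lt_iff_inv_lt]
  have hker := memLp_inv_norm_ball hq0 hq2 2
  set C := (eLpNorm (fun z : ℂ => ‖z‖⁻¹) q (volume.restrict (ball 0 2))).toReal with hC
  -- Hölder gives the constant `C / π`; adding `1` makes positivity immediate.
  refine ⟨C / Real.pi + 1, by positivity, fun k α X N hk _ _ hX hc hN => ?_⟩
  have hN2 : ∀ σ, ContDiffOn ℝ 2 (N σ) cdisc := fun σ =>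
    (hN.isNormalFrame.smooth σ).1.of_le (by exact_mod_cast (by omega : 2 ≤ k - 1))
  have ha := contDiffOn_torsion hN2 0 1 0
  have hb := contDiffOn_torsion hN2 0 1 1
  have hf : ∀ z ∈ disc, normalCurvature X N z * area X z =
      pd (torsion N 0 1 0) 1 z - pd (torsion N 0 1 1) 0 z := fun z hz =>
    normalCurvature_mul_area hX hc (fun σ => (hN2 σ).differentiableOn (by norm_num))
      hN.isNormalFrame.orthonormal (disc_subset_cdisc hz)
  have hae : (fun z => normalCurvature X N z * area X z) =ᵐ[volume.restrict disc]
      fun z => pd (torsion N 0 1 0) 1 z - pd (torsion N 0 1 1) 0 z :=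
    (ae_restrict_iff' measurableSet_disc).mpr (.of_forall hf)
  have hcont : ContinuousOn (fun z => pd (torsion N 0 1 0) 1 z - pd (torsion N 0 1 1) 0 z) cdisc :=
    (continuousOn_pd ha 1).sub (continuousOn_pd hb 0)
  have hmem : MemLp (fun z => pd (torsion N 0 1 0) 1 z - pd (torsion N 0 1 1) 0 z) p
      (volume.restrict disc) := by
    -- The frame is `C²` up to the boundary because `k - 1 ≥ 2`, so the curl is continuous on the
    -- compact disc and hence bounded.
    obtain ⟨M, hM⟩ := isCompact_cdisc.exists_bound_of_continuousOn hcont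
    exact MemLp.of_bound hcont.integrableOn_disc.aestronglyMeasurable M
      ((ae_restrict_iff' measurableSet_disc).mpr
        (.of_forall fun z hz => hM z (disc_subset_cdisc hz)))
  refine ⟨(memLp_congr_ae hae).mpr hmem, fun w hw => ?_⟩
  rw [eLpNorm_congr_ae hae]
  set f := fun z => pd (torsion N 0 1 0) 1 z - pd (torsion N 0 1 1) 0 z with hfdef
  have hkw : MemLp (fun z : ℂ => ‖z - w‖⁻¹) q (volume.restrict disc) :=
    ⟨by fun_prop, (eLpNorm_inv_norm_sub_le hw q).trans_lt hker.2⟩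
  have hprod : MemLp (fun z => f z * ‖z - w‖⁻¹) 1 (volume.restrict disc) := hkw.mul' hmem
  have hbound := pi_mul_norm_le ha hb (fun φ hφ => hN.integral_eq_zero hX hc hk hφ) hw
    (memLp_one_iff_integrable.mp hprod)
  have hholder : ∫ z in disc, ‖f z * ‖z - w‖⁻¹‖ ≤
      (eLpNorm f p (volume.restrict disc)).toReal * C := by
    rw [integral_norm_eq_lintegral_enorm hprod.1, ← eLpNorm_one_eq_lintegral_enorm, hC,
      ← ENNReal.toReal_mul]
    refine ENNReal.toReal_mono (ENNReal.mul_ne_top hmem.2.ne hker.2.ne) ?_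
    refine (eLpNorm_smul_le_mul_eLpNorm (p := p) (q := q) (r := 1) hkw.1 hmem.1).trans ?_
    gcongr
    exact eLpNorm_inv_norm_sub_le hw q
  have hpi := Real.pi_pos
  have hE : 0 ≤ (eLpNorm f p (volume.restrict disc)).toReal := ENNReal.toReal_nonneg
  have h1 := hbound.trans hholder
  rw [mul_comm, ← le_div_iff₀ hpi] at h1
  calc ‖complexTorsion N w‖ ≤ (eLpNorm f p (volume.restrict disc)).toReal * C / Real.pi := h1
    _ ≤ _ := by
      rw [add_mul, mul_comm _ C, div_mul_eq_mul_div]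
      linarith
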